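/- Let $q\in[1,\infty]$ and $d\ge 1$, and equip $\mathbb{R}^d$ with the norm $\|x\|_q=(\sum_{j}|x_j|^q)^{1/q}$ (and $\|x\|_\infty=\max_j|x_j|$). For a profile $P=(p_1,\dots,p_n)$ of $n\ge1$ points of $\mathbb{R}^d$ and a facility location $f\in\mathbb{R}^d$ let $\mathrm{SC}(P,f)=\sum_{i=1}^n\|f-p_i\|_q$. The coordinate-wise median mechanism places the facility at $m(P)$, whose $j$-th coordinate is a median of $p_{1,j},\dots,p_{n,j}$ (ties for even $n$ being broken arbitrarily). Its approximation ratio in $L_q(\mathbb{R}^d)$ is $$\alpha=\sup_{n,P}\ \frac{\mathrm{SC}(P,m(P))}{\min_{l\in\mathbb{R}^d}\mathrm{SC}(P,l)},$$ where profiles for which numerator and denominator both vanish do not contribute. For a real number $q>1$ the equation $$2\Bigl(1-\tfrac1q\Bigr)a+\tfrac1q\,a^{(1-q)/q}-2+\tfrac1q=0$$ has exactly one root $a^*=a^*(q)$ in $(0,1)$, and $a^*<\tfrac12$. Put $$\delta^*=\frac{(a^*)^{1/q}+1-2a^*}{(1-a^*)^{1/q}},\qquad \lambda^*(q)=\Bigl(1+(\delta^*)^{q/(q-1)}\Bigr)^{-(q-1)/q},\qquad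 \mathrm{UB}(q)=\frac1{\lambda^*(q)},$$ and let $\mathrm{UB}(1)=1$, which is the limit of $\mathrm{UB}(q)$ as $q\to1^+$. Theorem. For every real $q\ge1$ and every $d$, the coordinate-wise median mechanism has approximation ratio at most $\mathrm{UB}(q)$ in $L_q(\mathbb{R}^d)$. The function $\mathrm{UB}$ is strictly increasing on $[1,\infty)$, with $\mathrm{UB}(1)=1=\lim_{q\to1^+}\mathrm{UB}(q)$, $\mathrm{UB}(2)=\sqrt{6\sqrt3-8}\approx1.55$, and $\mathrm{UB}(q)\to3$ as $q\to\infty$. In particular the approximation ratio is at most $3$ for every $q\in[1,\infty]$, including $q=\infty$. -/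

import Mathlib

open scoped ENNReal

noncomputable section

namespace CoordMedian

/-- The `L_q` norm on `ℝ^d`, `q ∈ [1, ∞]`: the norm of Mathlib's `PiLp`, that is
`(∑ j, |x j| ^ q) ^ (1 / q)` for finite `q` and `max_j |x j|` for `q = ∞`. -/
def lqNorm {d : ℕ} (q : ℝ≥0∞) (x : Fin d → ℝ) : ℝ := ‖WithLp.toLp q x‖

/-- Utilitarian social cost of placing the facility at `f` when the agents are located at
`P 0, …, P (n - 1)`. -/
def socialCost {d n : ℕ} (q : ℝ≥0∞) (P : Fin n → Fin d → ℝ) (f : Fin d → ℝ) : ℝ :=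
  ∑ i, lqNorm q (f - P i)

/-- The optimal social cost. -/
def optCost {d n : ℕ} (q : ℝ≥0∞) (P : Fin n → Fin d → ℝ) : ℝ :=
  ⨅ l : Fin d → ℝ, socialCost q P l

/-- A (deterministic) mechanism for facility location in `ℝ^d`: for every number `n` of agents it
maps the profile of reported locations to a location of the facility. -/
abbrev Mechanism (d : ℕ) : Type := (n : ℕ) → (Fin n → Fin d → ℝ) → (Fin d → ℝ)

/-- The approximation ratio of a mechanism in `L_q(ℝ^d)`: the supremum over all `n ≥ 1` and all
profiles of the ratio of the mechanism's social cost to the optimal one. The quotient is taken in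
`[0, ∞]`, so that `c / 0 = ∞` for `c > 0`, while profiles on which both costs vanish do not
contribute (`0 / 0 = 0`). -/
def approxRatio {d : ℕ} (q : ℝ≥0∞) (M : Mechanism d) : ℝ≥0∞ :=
  ⨆ (n : ℕ) (_ : 1 ≤ n) (P : Fin n → Fin d → ℝ),
    ENNReal.ofReal (socialCost q P (M n P)) / ENNReal.ofReal (optCost q P)

/-- `m` is a median of the numbers `x 0, …, x (n - 1)`: at most half of them are smaller than `m`
and at most half of them are larger. For odd `n` this is the middle value; for even `n` it is any
point between the two middle values (both included), i.e. every way of breaking ties is allowed. -/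
def IsMedian {n : ℕ} (x : Fin n → ℝ) (m : ℝ) : Prop :=
  2 * (Finset.univ.filter fun i => x i < m).card ≤ n ∧
    2 * (Finset.univ.filter fun i => m < x i).card ≤ n

/-- `M` is a coordinate-wise median mechanism: each coordinate of its output is a median of the
corresponding coordinates of the reports, with arbitrary tie-breaking. -/
def IsCoordinatewiseMedian {d : ℕ} (M : Mechanism d) : Prop :=
  ∀ (n : ℕ), 1 ≤ n → ∀ (P : Fin n → Fin d → ℝ) (j : Fin d), IsMedian (fun i => P i j) (M n P j)

/-- Left-hand side of the equation
`2 (1 - 1/q) a + (1/q) a ^ ((1-q)/q) - 2 + 1/q = 0` that determines `a*`. -/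
def eqnLHS (q a : ℝ) : ℝ :=
  2 * (1 - 1 / q) * a + 1 / q * a ^ ((1 - q) / q) - 2 + 1 / q

/-- `a*(q)`: the (smallest) root of the equation in `(0, 1)`. For `q > 1` there is exactly one;
the equation also has the extraneous root `a = 1`, for every `q`. -/
def aStar (q : ℝ) : ℝ := sInf {a : ℝ | 0 < a ∧ a < 1 ∧ eqnLHS q a = 0}

/-- `δ*(q) = (a* ^ (1/q) + 1 - 2 a*) / (1 - a*) ^ (1/q)`. -/
def deltaStar (q : ℝ) : ℝ :=
  (aStar q ^ (1 / q) + 1 - 2 * aStar q) / (1 - aStar q) ^ (1 / q)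

/-- `λ*(q) = (1 + δ* ^ (q/(q-1))) ^ (-(q-1)/q)` for `q > 1`. At `q = 1` the equation for `a*` is an
identity and the exponent `q/(q-1)` is infinite; there `λ*` is given by its limit value `1`. -/
def lambdaStar (q : ℝ) : ℝ :=
  if q = 1 then 1 else (1 + deltaStar q ^ (q / (q - 1))) ^ (-((q - 1) / q))

/-- The upper bound `UB(q) = 1 / λ*(q)`. -/
def UB (q : ℝ) : ℝ := 1 / lambdaStar q

end CoordMedian

end

noncomputable section

namespace CoordMedian

/-! ### From a pointwise inequality to the approximation ratio. -/

section Cost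

variable {d n : ℕ} {q : ℝ≥0∞}

/-! Put the median at the origin and fix a competitor `l`. In each coordinate at most half of the
agents lie strictly on the side of `l`, so any nonnegative combination of the side signs sums to at
most `0`. It therefore suffices to bound `c‖x‖` minus such a combination by `‖l - x‖` for a single
agent `x` (`approxRatio_le_of_pointwise`).

For finite `q` the weights are proportional to `|l j| ^ q`; splitting the coordinates by side leaves
an inequality in two reals `v` and `b`, where `b` is the share of `‖l‖ ^ q` on the agent's side
(`pointwise_bound`). Maximising over `b` produces `δ*` (`deltaFun_le_deltaStar`), and Hölder over
`v` produces `UB` (`scalar_bound_UB`).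

`UB q` is the norm of `(1, δ*)` with exponent `q / (q - 1)`. As `q` grows, `δ*` grows and the
exponent falls, and both raise the norm. The limits follow from bounds on `δ*`, and `q = ∞` gets a
direct choice of weights. -/

lemma lqNorm_nonneg (hq : 1 ≤ q) (x : Fin d → ℝ) : 0 ≤ lqNorm q x := by
  have : Fact (1 ≤ q) := ⟨hq⟩
  exact norm_nonneg _

lemma lqNorm_add_le (hq : 1 ≤ q) (x y : Fin d → ℝ) :
    lqNorm q (x + y) ≤ lqNorm q x + lqNorm q y := by
  have : Fact (1 ≤ q) := ⟨hq⟩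
  rw [lqNorm, WithLp.toLp_add]
  exact norm_add_le _ _

lemma lqNorm_neg (hq : 1 ≤ q) (x : Fin d → ℝ) : lqNorm q (-x) = lqNorm q x := by
  have : Fact (1 ≤ q) := ⟨hq⟩
  rw [lqNorm, WithLp.toLp_neg]
  exact norm_neg _

lemma abs_apply_le_lqNorm (hq : 1 ≤ q) (x : Fin d → ℝ) (j : Fin d) : |x j| ≤ lqNorm q x := by
  have : Fact (1 ≤ q) := ⟨hq⟩
  exact PiLp.norm_apply_le (WithLp.toLp q x) j

lemma lqNorm_ofReal {r : ℝ} (hr : 1 ≤ r) (x : Fin d → ℝ) :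
    lqNorm (ENNReal.ofReal r) x = (∑ j, |x j| ^ r) ^ (1 / r) := by
  have h0 : 0 ≤ r := by linarith
  have h : (ENNReal.ofReal r).toReal = r := ENNReal.toReal_ofReal h0
  rw [lqNorm, PiLp.norm_eq_sum (by rw [h]; linarith), h]
  rfl

lemma lqNorm_ofReal_rpow {r : ℝ} (hr : 1 ≤ r) (x : Fin d → ℝ) :
    lqNorm (ENNReal.ofReal r) x ^ r = ∑ j, |x j| ^ r := by
  rw [lqNorm_ofReal hr, ← Real.rpow_mul (Finset.sum_nonneg fun j _ => by positivity),
    one_div_mul_cancel (by linarith), Real.rpow_one]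

/-- Whether `x j` lies strictly on the same side of the origin as `l j`, as a sign. -/
def sideSign (l x : Fin d → ℝ) (j : Fin d) : ℝ := if 0 < l j * x j then 1 else -1

lemma sum_sideSign_nonpos {P : Fin n → Fin d → ℝ} {m : Fin d → ℝ} {j : Fin d}
    (hm : IsMedian (fun i => P i j) (m j)) (l : Fin d → ℝ) :
    ∑ i, sideSign l (P i - m) j ≤ 0 := by
  -- Agents level with the median count as `-1`, so ties only lower the sum.
  have key : 2 * (Finset.univ.filter fun i => 0 < l j * (P i - m) j).card ≤ n := by
    rcases lt_trichotomy (l j) 0 with h | h | h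
    · refine le_trans (Nat.mul_le_mul_left 2 (Finset.card_le_card ?_)) hm.1
      intro i
      simp only [Finset.mem_filter, Finset.mem_univ, true_and, Pi.sub_apply]
      intro hi
      nlinarith
    · simp [h]
    · refine le_trans (Nat.mul_le_mul_left 2 (Finset.card_le_card ?_)) hm.2
      intro i
      simp only [Finset.mem_filter, Finset.mem_univ, true_and, Pi.sub_apply]
      intro hi
      nlinarith
  have hsum : ∑ i, sideSign l (P i - m) j
      = 2 * ((Finset.univ.filter fun i => 0 < l j * (P i - m) j).card : ℝ) - n := by
    have : ∀ i, sideSign l (P i - m) j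
        = 2 * (if 0 < l j * (P i - m) j then (1 : ℝ) else 0) - 1 := by
      intro i
      unfold sideSign
      split_ifs <;> norm_num
    simp only [this, Finset.sum_sub_distrib, ← Finset.mul_sum, Finset.sum_boole]
    simp
  rw [hsum]
  have : (2 * ((Finset.univ.filter fun i => 0 < l j * (P i - m) j).card : ℝ)) ≤ n := by
    exact_mod_cast key
  linarith

/-- A pointwise lower bound on the distance to `l` that differs from `c` times the distance to the
origin by a nonnegative combination of sides bounds the ratio of the median mechanism. -/
lemma approxRatio_le_of_pointwise (hq : 1 ≤ q) {c : ℝ} (hc : 0 < c)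
    (H : ∀ l : Fin d → ℝ, ∃ w : Fin d → ℝ, (∀ j, 0 ≤ w j) ∧ ∀ x : Fin d → ℝ,
      c * lqNorm q x - ∑ j, w j * sideSign l x j ≤ lqNorm q (l - x))
    {M : Mechanism d} (hM : IsCoordinatewiseMedian M) :
    approxRatio q M ≤ ENNReal.ofReal (1 / c) := by
  refine iSup_le fun n => iSup_le fun hn => iSup_le fun P => ?_
  set m := M n P with hmdef
  have hle : ∀ l : Fin d → ℝ, c * socialCost q P m ≤ socialCost q P l := by
    intro l
    obtain ⟨w, hw, hx⟩ := H (l - m)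
    have h1 : ∑ i, ∑ j, w j * sideSign (l - m) (P i - m) j ≤ 0 := by
      rw [Finset.sum_comm]
      refine Finset.sum_nonpos fun j _ => ?_
      rw [← Finset.mul_sum]
      exact mul_nonpos_of_nonneg_of_nonpos (hw j) (sum_sideSign_nonpos (hM n hn P j) _)
    have h2 : ∑ i, (c * lqNorm q (m - P i) - ∑ j, w j * sideSign (l - m) (P i - m) j)
        ≤ ∑ i, lqNorm q (l - P i) := by
      refine Finset.sum_le_sum fun i _ => ?_
      have := hx (P i - m)
      rwa [sub_sub_sub_cancel_right, ← lqNorm_neg hq (P i - m), neg_sub] at this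
    rw [Finset.sum_sub_distrib, ← Finset.mul_sum] at h2
    unfold socialCost
    linarith
  have hopt : c * socialCost q P m ≤ optCost q P := le_ciInf hle
  refine ENNReal.div_le_of_le_mul ?_
  rw [← ENNReal.ofReal_mul (by positivity)]
  refine ENNReal.ofReal_le_ofReal ?_
  rw [one_div, ← div_eq_inv_mul, le_div_iff₀ hc, mul_comm]
  exact hopt

/-- Homogeneity: dividing lengths by `(A + B) ^ (1 / r)` reduces to `A + B = 1`, with `b = A / (A +
B)`. -/
lemma scaled_bound {r c : ℝ} (hr : 1 ≤ r)
    (H : ∀ v b : ℝ, 0 ≤ v → 0 ≤ b → b ≤ 1 →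
      c * (v + b ^ (1 / r)) + c * (1 - 2 * b) ≤ (v ^ r + (1 - b)) ^ (1 / r))
    {v A B : ℝ} (hv : 0 ≤ v) (hA : 0 ≤ A) (hB : 0 ≤ B) (hAB : 0 < A + B) :
    c * (v + A ^ (1 / r)) + c * (A + B) ^ (1 / r - 1) * (B - A) ≤ (v ^ r + B) ^ (1 / r) := by
  have hr0 : 0 < r := by linarith
  obtain ⟨T, hT⟩ : ∃ T, T = A + B := ⟨_, rfl⟩
  rw [← hT] at hAB ⊢
  have hTs : 0 < T ^ (1 / r) := by positivity
  have h := H (v / T ^ (1 / r)) (A / T) (by positivity) (by positivity)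
    (by rw [div_le_one hAB]; linarith)
  have e1 : (v / T ^ (1 / r)) ^ r = v ^ r / T := by
    rw [Real.div_rpow hv hTs.le, ← Real.rpow_mul hAB.le, one_div_mul_cancel hr0.ne', Real.rpow_one]
  have e2 : v ^ r / T + (1 - A / T) = (v ^ r + B) / T := by
    field_simp
    linarith
  rw [e1, e2, Real.div_rpow hA hAB.le, Real.div_rpow (by positivity) hAB.le,
    le_div_iff₀ hTs] at h
  have e3 : T ^ (1 / r - 1) = T ^ (1 / r) / T := by
    rw [Real.rpow_sub_one hAB.ne']
  rw [e3]
  refine le_trans (le_of_eq ?_) h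
  have : B = T - A := by linarith
  rw [this]
  field_simp
  ring

lemma abs_rpow_add_abs_rpow_le {r a b : ℝ} (hr : 1 ≤ r) (h : a * b ≤ 0) :
    |a| ^ r + |b| ^ r ≤ |a - b| ^ r := by
  have : |a - b| = |a| + |b| := by
    rcases le_total 0 a with ha | ha <;> rcases le_total 0 b with hb | hb <;>
      cases abs_cases a <;> cases abs_cases b <;> cases abs_cases (a - b) <;> nlinarith
  rw [this]
  exact Real.add_rpow_le_rpow_add (abs_nonneg _) (abs_nonneg _) hr

lemma pointwise_bound {r c : ℝ} (hr : 1 ≤ r) (hc : 0 ≤ c) (hc1 : c ≤ 1)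
    (H : ∀ v b : ℝ, 0 ≤ v → 0 ≤ b → b ≤ 1 →
      c * (v + b ^ (1 / r)) + c * (1 - 2 * b) ≤ (v ^ r + (1 - b)) ^ (1 / r))
    (l : Fin d → ℝ) : ∃ w : Fin d → ℝ, (∀ j, 0 ≤ w j) ∧ ∀ x : Fin d → ℝ,
      c * lqNorm (ENNReal.ofReal r) x - ∑ j, w j * sideSign l x j
        ≤ lqNorm (ENNReal.ofReal r) (l - x) := by
  have hq : 1 ≤ ENNReal.ofReal r := by simpa using hr
  have hr0 : 0 < r := by linarith
  have hT0 : 0 ≤ ∑ j, |l j| ^ r := Finset.sum_nonneg fun j _ => by positivity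
  rcases hT0.eq_or_lt with hT | hT
  · refine ⟨0, fun j => le_rfl, fun x => ?_⟩
    have hl : l = 0 := by
      funext j
      have := (Finset.sum_eq_zero_iff_of_nonneg
        (fun j _ => Real.rpow_nonneg (abs_nonneg (l j)) r)).1 hT.symm j (Finset.mem_univ j)
      rw [Real.rpow_eq_zero (abs_nonneg _) hr0.ne'] at this
      simpa using this
    simp only [hl, zero_sub, lqNorm_neg hq]
    simpa using mul_le_of_le_one_left (lqNorm_nonneg hq x) hc1
  -- With these weights the signed sum depends on `x` only through `A - B`, the same-side mass of
  -- `l` minus the rest. `lS` is `l` restricted to the same-side coordinates: moving `x` by `lS`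
  -- costs `A ^ (1 / r)`, while each remaining coordinate adds at least `|l j| ^ r` to the `r`-th
  -- power of the distance to `l`.
  refine ⟨fun j => c * (∑ j, |l j| ^ r) ^ (1 / r - 1) * |l j| ^ r, fun j => by positivity,
    fun x => ?_⟩
  set lS : Fin d → ℝ := fun j => if 0 < l j * x j then l j else 0 with hlS
  set A := ∑ j, |lS j| ^ r with hA
  set B := ∑ j, (if 0 < l j * x j then 0 else |l j| ^ r) with hB
  have hA0 : 0 ≤ A := Finset.sum_nonneg fun j _ => by positivity
  have hB0 : 0 ≤ B := Finset.sum_nonneg fun j _ => by split_ifs <;> positivity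
  have hAB : ∑ j, |l j| ^ r = A + B := by
    rw [hA, hB, ← Finset.sum_add_distrib]
    refine Finset.sum_congr rfl fun j _ => ?_
    simp only [hlS]
    split_ifs <;> simp [Real.zero_rpow hr0.ne']
  have hsum : ∑ j, |l j| ^ r * sideSign l x j = A - B := by
    rw [hA, hB, ← Finset.sum_sub_distrib]
    refine Finset.sum_congr rfl fun j _ => ?_
    simp only [hlS, sideSign]
    split_ifs <;> simp [Real.zero_rpow hr0.ne']
  have hx : lqNorm (ENNReal.ofReal r) x
      ≤ lqNorm (ENNReal.ofReal r) (x - lS) + A ^ (1 / r) := by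
    have := lqNorm_add_le hq (x - lS) lS
    rwa [sub_add_cancel, lqNorm_ofReal hr lS] at this
  have hlx : (lqNorm (ENNReal.ofReal r) (x - lS) ^ r + B) ^ (1 / r)
      ≤ lqNorm (ENNReal.ofReal r) (l - x) := by
    have hv := lqNorm_nonneg hq (x - lS)
    rw [lqNorm_ofReal hr (l - x)]
    refine Real.rpow_le_rpow (by positivity) ?_ (by positivity)
    rw [lqNorm_ofReal_rpow hr, hB, ← Finset.sum_add_distrib]
    refine Finset.sum_le_sum fun j _ => ?_
    simp only [hlS, Pi.sub_apply]
    split_ifs with h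
    · rw [add_zero, abs_sub_comm]
    · have := abs_rpow_add_abs_rpow_le hr (not_lt.1 h)
      rw [sub_zero]
      linarith
  have hmain := scaled_bound hr H (lqNorm_nonneg hq (x - lS)) hA0 hB0 (hAB ▸ hT)
  simp only [mul_assoc, ← Finset.mul_sum]
  rw [hsum, hAB]
  have := mul_le_mul_of_nonneg_left hx hc
  linarith

theorem approxRatio_le_of_scalar {r c : ℝ} (hr : 1 ≤ r) (hc : 0 < c) (hc1 : c ≤ 1)
    (H : ∀ v b : ℝ, 0 ≤ v → 0 ≤ b → b ≤ 1 →
      c * (v + b ^ (1 / r)) + c * (1 - 2 * b) ≤ (v ^ r + (1 - b)) ^ (1 / r))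
    {M : Mechanism d} (hM : IsCoordinatewiseMedian M) :
    approxRatio (ENNReal.ofReal r) M ≤ ENNReal.ofReal (1 / c) :=
  approxRatio_le_of_pointwise (by simpa using hr) hc (pointwise_bound hr hc.le hc1 H) hM

theorem approxRatio_top_le {M : Mechanism d} (hM : IsCoordinatewiseMedian M) :
    approxRatio ∞ M ≤ 3 := by
  have h3 : (3 : ℝ≥0∞) = ENNReal.ofReal (1 / (1 / 3 : ℝ)) := by norm_num
  rw [h3]
  refine approxRatio_le_of_pointwise le_top (by norm_num) (fun l => ?_) hM
  rcases isEmpty_or_nonempty (Fin d) with hd | hd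
  · refine ⟨0, fun j => le_rfl, fun x => ?_⟩
    simp [lqNorm, Subsingleton.elim x 0, Subsingleton.elim l 0]
  obtain ⟨k, hk⟩ := Finite.exists_max fun j => |l j|
  have hl : lqNorm ∞ l = |l k| := by
    refine le_antisymm ?_ (abs_apply_le_lqNorm le_top l k)
    rw [lqNorm, PiLp.norm_eq_ciSup]
    exact ciSup_le hk
  -- Only a largest coordinate of `l` matters. On the same side the triangle inequality suffices; on
  -- the other side `‖l - x‖` is already at least `‖l‖`.
  refine ⟨Pi.single k (|l k| / 3), fun j => ?_, fun x => ?_⟩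
  · by_cases h : j = k
    · subst h
      simpa using by positivity
    · simp [h]
  rw [Finset.sum_eq_single k (fun j _ hj => by simp [hj]) (by simp), Pi.single_eq_same]
  have htri : lqNorm ∞ x ≤ |l k| + lqNorm ∞ (l - x) := by
    have := lqNorm_add_le le_top l (-(l - x))
    rwa [lqNorm_neg le_top, neg_sub, add_sub_cancel, hl] at this
  have h0 := lqNorm_nonneg le_top (l - x)
  have hkx := abs_apply_le_lqNorm le_top (l - x) k
  unfold sideSign
  split_ifs with h
  · linarith
  · have : |l k| ≤ |(l - x) k| := by
      have h1 := abs_rpow_add_abs_rpow_le le_rfl (not_lt.1 h)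
      simp only [Real.rpow_one] at h1
      rw [Pi.sub_apply]
      linarith [abs_nonneg (x k)]
    linarith

end Cost


/-! ### The equation for `a*`: existence and uniqueness of the root. -/

section Equation

open Set

variable {q : ℝ}

lemma hasDerivAt_eqnLHS (q : ℝ) {a : ℝ} (ha : 0 < a) :
    HasDerivAt (eqnLHS q)
      (2 * (1 - 1 / q) + 1 / q * ((1 - q) / q * a ^ ((1 - q) / q - 1))) a := by
  have h1 := ((hasDerivAt_id a).const_mul (2 * (1 - 1 / q)))
  have h2 := (Real.hasDerivAt_rpow_const (x := a) (p := (1 - q) / q) (Or.inl ha.ne')).const_mul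
    (1 / q)
  exact (((h1.add h2).sub_const 2).add_const (1 / q)).congr_deriv (by simp)

lemma eqnLHS_one (q : ℝ) : eqnLHS q 1 = 0 := by
  unfold eqnLHS
  rw [Real.one_rpow]
  ring

lemma continuousOn_eqnLHS (q : ℝ) : ContinuousOn (eqnLHS q) (Ioi 0) := fun _ ha =>
  (hasDerivAt_eqnLHS q ha).continuousAt.continuousWithinAt

lemma strictConvexOn_eqnLHS (hq : 1 < q) : StrictConvexOn ℝ (Ioi 0) (eqnLHS q) := by
  refine StrictMonoOn.strictConvexOn_of_deriv (convex_Ioi 0) (continuousOn_eqnLHS q) ?_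
  rw [interior_Ioi]
  intro a ha b hb hab
  rw [(hasDerivAt_eqnLHS q ha).deriv, (hasDerivAt_eqnLHS q hb).deriv]
  have hneg : (1 - q) / q < 0 := div_neg_of_neg_of_pos (by linarith) (by linarith)
  have hlt : b ^ ((1 - q) / q - 1) < a ^ ((1 - q) / q - 1) :=
    Real.rpow_lt_rpow_of_neg ha hab (by linarith)
  have := mul_lt_mul_of_neg_left hlt hneg
  have hq' : 0 < 1 / q := by positivity
  have := mul_lt_mul_of_pos_left this hq'
  linarith

lemma eqnLHS_half_neg (hq : 1 < q) : eqnLHS q (1 / 2) < 0 := by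
  have hq0 : 0 < q := by linarith
  have hs : 0 < 1 / q := by positivity
  have hs1 : 1 / q < 1 := by rw [div_lt_one hq0]; exact hq
  obtain ⟨s, hsd⟩ : ∃ s, s = 1 / q := ⟨_, rfl⟩
  have he : (1 - q) / q = s - 1 := by rw [hsd]; field_simp
  unfold eqnLHS
  rw [he, ← hsd]
  rw [← hsd] at hs hs1
  -- In logarithms: `log s ≤ s - 1` and `log 2 < 1`.
  have h2 : ((1 : ℝ) / 2) ^ (s - 1) * s < 1 := by
    rw [← Real.log_neg_iff (by positivity), Real.log_mul (by positivity) hs.ne',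
      Real.log_rpow (by norm_num), one_div, Real.log_inv]
    have h3 := Real.log_le_sub_one_of_pos hs
    have h4 := Real.log_two_lt_d9
    nlinarith
  nlinarith

lemma exists_eqnLHS_pos (hq : 1 < q) : ∃ b, 0 < b ∧ b < 1 / 2 ∧ 0 < eqnLHS q b := by
  have hq0 : 0 < q := by linarith
  have hs : 0 < 1 / q := by positivity
  have hs1 : 1 / q < 1 := by rw [div_lt_one hq0]; exact hq
  obtain ⟨s, hsd⟩ : ∃ s, s = 1 / q := ⟨_, rfl⟩
  have he : (1 - q) / q = s - 1 := by rw [hsd]; field_simp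
  unfold eqnLHS
  rw [he, ← hsd]
  rw [← hsd] at hs hs1
  have hs2 : 0 < s / 2 := by positivity
  have h1s : 0 < 1 - s := by linarith
  have hb : 0 < (s / 2) ^ (1 / (1 - s)) := by positivity
  -- Chosen so that `s * b ^ (s - 1) = 2`, which cancels the constant `-2`.
  refine ⟨(s / 2) ^ (1 / (1 - s)), hb, ?_, ?_⟩
  · calc (s / 2) ^ (1 / (1 - s)) ≤ (s / 2) ^ (1 : ℝ) := by
          refine Real.rpow_le_rpow_of_exponent_ge hs2 (by linarith) ?_
          rw [le_div_iff₀ h1s]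
          linarith
      _ < 1 / 2 := by rw [Real.rpow_one]; linarith
  · have : ((s / 2) ^ (1 / (1 - s))) ^ (s - 1) = (s / 2)⁻¹ := by
      rw [← Real.rpow_mul hs2.le, show 1 / (1 - s) * (s - 1) = -1 by field_simp; ring,
        Real.rpow_neg_one]
    rw [this, show s * (s / 2)⁻¹ = 2 by field_simp]
    nlinarith

lemma exists_eqnLHS_root (hq : 1 < q) :
    ∃ a, 0 < a ∧ a < 1 / 2 ∧ eqnLHS q a = 0 := by
  obtain ⟨b, hb, hb2, hpos⟩ := exists_eqnLHS_pos hq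
  have hc : ContinuousOn (eqnLHS q) (Icc b (1 / 2)) :=
    (continuousOn_eqnLHS q).mono fun x hx => lt_of_lt_of_le hb hx.1
  obtain ⟨a, ha, h0⟩ := intermediate_value_Icc' hb2.le hc ⟨(eqnLHS_half_neg hq).le, hpos.le⟩
  refine ⟨a, lt_of_lt_of_le hb ha.1, lt_of_le_of_ne ha.2 ?_, h0⟩
  rintro rfl
  exact (eqnLHS_half_neg hq).ne h0

/-- Strict convexity between the two zeros `a` and `1`; the extraneous root at `1` is what fixes the
signs. -/
lemma eqnLHS_neg_of_root {a b : ℝ} (hq : 1 < q) (ha : 0 < a) (h0 : eqnLHS q a = 0)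
    (hab : a < b) (hb : b < 1) : eqnLHS q b < 0 := by
  have h := (strictConvexOn_eqnLHS hq).lt_on_openSegment (x := a) (y := 1) (z := b) ha
    (mem_Ioi.2 one_pos) (hab.trans hb).ne (by rw [openSegment_eq_Ioo (hab.trans hb)]; exact ⟨hab, hb⟩)
  rwa [h0, eqnLHS_one, max_self] at h

lemma eqnLHS_pos_of_root {a b : ℝ} (hq : 1 < q) (hb : 0 < b) (hab : b < a) (ha : a < 1)
    (h0 : eqnLHS q a = 0) : 0 < eqnLHS q b := by
  have h := (strictConvexOn_eqnLHS hq).lt_on_openSegment (x := b) (y := 1) (z := a) hb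
    (mem_Ioi.2 one_pos) (hab.trans ha).ne (by rw [openSegment_eq_Ioo (hab.trans ha)]; exact ⟨hab, ha⟩)
  rw [h0, eqnLHS_one] at h
  simpa using h

lemma eqnLHS_root_unique {a b : ℝ} (hq : 1 < q) (ha : 0 < a) (ha1 : a < 1)
    (h0 : eqnLHS q a = 0) (hb : 0 < b) (hb1 : b < 1) (hb0 : eqnLHS q b = 0) : b = a := by
  rcases lt_trichotomy a b with h | h | h
  · exact absurd hb0 (eqnLHS_neg_of_root hq ha h0 h hb1).ne
  · exact h.symm
  · exact absurd hb0 (eqnLHS_pos_of_root hq hb h ha1 h0).ne'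

lemma aStar_eq_of_root {a : ℝ} (hq : 1 < q) (ha : 0 < a) (ha1 : a < 1) (h0 : eqnLHS q a = 0) :
    aStar q = a := by
  have : {b : ℝ | 0 < b ∧ b < 1 ∧ eqnLHS q b = 0} = {a} := by
    ext b
    simp only [mem_ofPred_eq, mem_singleton_iff]
    constructor
    · rintro ⟨hb, hb1, hb0⟩
      exact eqnLHS_root_unique hq ha ha1 h0 hb hb1 hb0
    · rintro rfl
      exact ⟨ha, ha1, h0⟩
  rw [aStar, this, csInf_singleton]

lemma aStar_spec (hq : 1 < q) : 0 < aStar q ∧ aStar q < 1 / 2 ∧ eqnLHS q (aStar q) = 0 := by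
  obtain ⟨a, ha, ha2, h0⟩ := exists_eqnLHS_root hq
  rw [aStar_eq_of_root hq ha (by linarith) h0]
  exact ⟨ha, ha2, h0⟩

end Equation

/-! ### `δ*` as a maximum, its bounds and its monotonicity. -/

section Delta

open Set

variable {q : ℝ}

/-- The function of `b` whose maximum over `[0, 1)` is `δ*`, with `s = 1 / q`. -/
def deltaFun (s b : ℝ) : ℝ := (b ^ s + 1 - 2 * b) / (1 - b) ^ s

lemma deltaStar_eq (q : ℝ) : deltaStar q = deltaFun (1 / q) (aStar q) := rfl

lemma hasDerivAt_deltaFun (hq : 0 < q) {b : ℝ} (hb : 0 < b) (hb1 : b < 1) :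
    HasDerivAt (deltaFun (1 / q)) (eqnLHS q b / (1 - b) ^ (1 / q + 1)) b := by
  have h1b : 0 < 1 - b := by linarith
  have h1 := ((Real.hasDerivAt_rpow_const (x := b) (p := 1 / q) (Or.inl hb.ne')).add_const
    (1 : ℝ)).sub ((hasDerivAt_id b).const_mul (2 : ℝ))
  have h2 := ((hasDerivAt_id b).const_sub (1 : ℝ)).rpow_const (p := 1 / q) (Or.inl h1b.ne')
  have hd : (1 - b) ^ (1 / q) ≠ 0 := by positivity
  have h3 := h1.div h2 hd
  refine h3.congr_deriv ?_
  have e1 : (1 - b) ^ (1 / q - 1) = (1 - b) ^ (1 / q) / (1 - b) := Real.rpow_sub_one h1b.ne' _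
  have e2 : (1 - b) ^ (1 / q + 1) = (1 - b) ^ (1 / q) * (1 - b) := Real.rpow_add_one h1b.ne' _
  have e3 : b ^ (1 / q) = b ^ (1 / q - 1) * b := by
    rw [Real.rpow_sub_one hb.ne']
    field_simp
  have e4 : (1 - q) / q = 1 / q - 1 := by field_simp
  simp only [id, Pi.sub_apply] at *
  unfold eqnLHS
  rw [e1, e2, e3, e4]
  generalize b ^ (1 / q - 1) = X
  generalize (1 - b) ^ (1 / q) = Y at *
  generalize 1 / q = s
  field_simp
  ring

lemma continuousOn_deltaFun {s : ℝ} (hs : 0 ≤ s) : ContinuousOn (deltaFun s) (Ico 0 1) := by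
  intro b hb
  have h1b : 0 < 1 - b := by linarith [hb.2]
  refine ContinuousAt.continuousWithinAt ?_
  unfold deltaFun
  refine ContinuousAt.div ?_ ?_ (by positivity)
  · exact ((Real.continuousAt_rpow_const b s (Or.inr hs)).add continuousAt_const).sub
      (by fun_prop)
  · exact ContinuousAt.rpow_const (by fun_prop) (Or.inl h1b.ne')

/-- The derivative in `b` has the sign of `eqnLHS q b`, positive before `a*` and negative after. -/
lemma deltaFun_le_deltaStar (hq : 1 < q) {b : ℝ} (hb : 0 ≤ b) (hb1 : b < 1) :
    deltaFun (1 / q) b ≤ deltaStar q := by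
  have hq0 : 0 < q := by linarith
  obtain ⟨ha, ha2, h0⟩ := aStar_spec hq
  have hc := continuousOn_deltaFun (s := 1 / q) (by positivity)
  rw [deltaStar_eq]
  rcases le_total b (aStar q) with h | h
  · refine monotoneOn_of_deriv_nonneg (convex_Icc 0 (aStar q)) (f := deltaFun (1 / q))
      (hc.mono fun x hx => ⟨hx.1, by linarith [hx.2]⟩) ?_ ?_ ⟨hb, h⟩ ⟨ha.le, le_rfl⟩ h
    · rw [interior_Icc]
      intro x hx
      exact (hasDerivAt_deltaFun hq0 hx.1
        (by linarith [hx.2])).differentiableAt.differentiableWithinAt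
    · rw [interior_Icc]
      intro x hx
      have hx1 : 0 < 1 - x := by linarith [hx.2]
      rw [(hasDerivAt_deltaFun hq0 hx.1 (by linarith)).deriv]
      exact div_nonneg (eqnLHS_pos_of_root hq hx.1 hx.2 (by linarith) h0).le (by positivity)
  · refine antitoneOn_of_deriv_nonpos (convex_Ico (aStar q) 1) (f := deltaFun (1 / q))
      (hc.mono fun x hx => ⟨ha.le.trans hx.1, hx.2⟩) ?_ ?_ ⟨le_rfl, by linarith⟩ ⟨h, hb1⟩ h
    · rw [interior_Ico]
      intro x hx
      exact (hasDerivAt_deltaFun hq0 (ha.trans hx.1)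
        hx.2).differentiableAt.differentiableWithinAt
    · rw [interior_Ico]
      intro x hx
      have hx1 : 0 < 1 - x := by linarith [hx.2]
      rw [(hasDerivAt_deltaFun hq0 (ha.trans hx.1) hx.2).deriv]
      exact div_nonpos_of_nonpos_of_nonneg (eqnLHS_neg_of_root hq ha h0 hx.1 hx.2).le
        (by positivity)

lemma one_le_deltaStar (hq : 1 < q) : 1 ≤ deltaStar q := by
  have h := deltaFun_le_deltaStar hq le_rfl one_pos
  have : (1 : ℝ) / q ≠ 0 := by positivity
  rw [one_div] at this
  simpa [deltaFun, Real.zero_rpow this] using h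

lemma numerator_le (hq : 1 < q) {b : ℝ} (hb : 0 ≤ b) (hb1 : b ≤ 1) :
    b ^ (1 / q) + 1 - 2 * b ≤ deltaStar q * (1 - b) ^ (1 / q) := by
  rcases hb1.eq_or_lt with rfl | h
  · have : (1 : ℝ) / q ≠ 0 := by positivity
    rw [sub_self, Real.zero_rpow this, Real.one_rpow]
    norm_num
  · have h1b : 0 < 1 - b := by linarith
    have := deltaFun_le_deltaStar hq hb h
    rwa [deltaFun, div_le_iff₀ (by positivity)] at this

lemma deltaStar_le_two (hq : 1 < q) : deltaStar q ≤ 2 := by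
  obtain ⟨ha, ha2, -⟩ := aStar_spec hq
  have h1 : 0 < 1 - aStar q := by linarith
  have hs : 1 / q ≤ 1 := by rw [div_le_one (by linarith)]; exact hq.le
  rw [deltaStar, div_le_iff₀ (by positivity)]
  have h2 : aStar q ^ (1 / q) ≤ 1 := Real.rpow_le_one ha.le (by linarith) (by positivity)
  have h3 : (1 - aStar q) ^ (1 : ℝ) ≤ (1 - aStar q) ^ (1 / q) :=
    Real.rpow_le_rpow_of_exponent_ge h1 (by linarith) hs
  rw [Real.rpow_one] at h3
  linarith

lemma deltaStar_le_of_near_one (hq : 1 < q) : deltaStar q ≤ 1 + 2 * (q - 1) := by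
  obtain ⟨ha, ha2, -⟩ := aStar_spec hq
  obtain ⟨a, hae⟩ : ∃ a, a = aStar q := ⟨_, rfl⟩
  have hq0 : 0 < q := by linarith
  have hs : 1 / q ≤ 1 := by rw [div_le_one (by linarith)]; exact hq.le
  have hs0 : 0 < 1 / q := by positivity
  rw [deltaStar]
  rw [← hae] at ha ha2 ⊢
  have h1 : 0 < 1 - a := by linarith
  rw [div_le_iff₀ (by positivity)]
  have h3 : (1 - a) ^ (1 : ℝ) ≤ (1 - a) ^ (1 / q) :=
    Real.rpow_le_rpow_of_exponent_ge h1 (by linarith) hs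
  rw [Real.rpow_one] at h3
  -- Factor out `a ^ (1 / q)`, bound the other factor by `-(1 - 1 / q) * log a`, and use `|log a * a
  -- ^ (1 / q)| < q`.
  have h4 : a ^ (1 / q) - a ≤ q - 1 := by
    have h5 := Real.abs_log_mul_self_rpow_lt a (1 / q) ha (by linarith) hs0
    rw [one_div_one_div, abs_lt] at h5
    have h6 : a = a ^ (1 / q) * a ^ (1 - 1 / q) := by
      rw [← Real.rpow_add ha, add_sub_cancel, Real.rpow_one]
    have h7 : 1 + Real.log a * (1 - 1 / q) ≤ a ^ (1 - 1 / q) := by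
      rw [Real.rpow_def_of_pos ha]
      linarith [Real.add_one_le_exp (Real.log a * (1 - 1 / q))]
    have h8 : 0 < a ^ (1 / q) := by positivity
    have h9 : a ^ (1 / q) - a = a ^ (1 / q) * (1 - a ^ (1 - 1 / q)) := by
      rw [mul_sub, ← h6, mul_one]
    have h10 : a ^ (1 / q) * (1 - a ^ (1 - 1 / q)) ≤
        (-(Real.log a * a ^ (1 / q))) * (1 - 1 / q) := by nlinarith
    have h11 : (-(Real.log a * a ^ (1 / q))) * (1 - 1 / q) ≤ q * (1 - 1 / q) :=
      mul_le_mul_of_nonneg_right (by linarith) (by linarith)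
    have h12 : q * (1 - 1 / q) = q - 1 := by field_simp
    linarith
  -- The factor `2` in the claim comes from `1 - a > 1 / 2`.
  nlinarith

lemma mul_log_le_of_lt_half {b : ℝ} (hb : 0 < b) (hb2 : b < 1 / 2) :
    (1 - b) * -Real.log (1 - b) < b * -Real.log b := by
  -- Compare the secant slopes of `log` from `1` to `b` and to `1 - b`.
  have h := strictConcaveOn_log_Ioi.secant_strict_mono (a := 1) (x := b) (y := 1 - b)
    (mem_Ioi.2 one_pos) (mem_Ioi.2 hb) (mem_Ioi.2 (by linarith)) (by linarith) (by linarith)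
    (by linarith)
  rw [Real.log_one, sub_zero, sub_zero, show 1 - b - 1 = -b by ring,
    show b - 1 = -(1 - b) by ring, div_neg, div_neg, neg_lt_neg_iff,
    div_lt_div_iff₀ (by linarith) hb] at h
  linarith

lemma deltaFun_strictAntiOn {b : ℝ} (hb : 0 < b) (hb2 : b < 1 / 2) :
    StrictAntiOn (fun s => deltaFun s b) (Icc 0 1) := by
  have h1b : 0 < 1 - b := by linarith
  have hderiv : ∀ s, HasDerivAt (fun s => deltaFun s b)
      ((b ^ s * Real.log b - (b ^ s + 1 - 2 * b) * Real.log (1 - b)) / (1 - b) ^ s) s := by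
    intro s
    have h1 := (((hasDerivAt_id s).const_rpow hb).add_const (1 : ℝ)).sub_const (2 * b)
    have h2 := (hasDerivAt_id s).const_rpow h1b
    have h3 := h1.div h2 (by simp only [id]; positivity)
    refine h3.congr_deriv ?_
    simp only [id]
    have : 0 < (1 - b) ^ s := by positivity
    field_simp
  refine strictAntiOn_of_deriv_neg (convex_Icc 0 1)
    (fun s _ => (hderiv s).continuousAt.continuousWithinAt) fun s hs => ?_
  rw [interior_Icc] at hs
  rw [(hderiv s).deriv]
  refine div_neg_of_neg_of_pos ?_ (by positivity)
  -- As `log b ≤ log (1 - b)`, replacing `b ^ s` by `b` can only raise the numerator, leaving `b *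
  -- log b - (1 - b) * log (1 - b)`.
  have hbs : b ≤ b ^ s := by
    simpa using Real.rpow_le_rpow_of_exponent_ge hb (by linarith) hs.2.le
  have hl : Real.log b ≤ Real.log (1 - b) := Real.log_le_log hb (by linarith)
  have := mul_log_le_of_lt_half hb hb2
  nlinarith

/-- The maximiser for `q` serves as a test point for `r`; `a* < 1 / 2` is needed here. -/
lemma deltaStar_strictMono {r : ℝ} (hq : 1 < q) (hqr : q < r) : deltaStar q < deltaStar r := by
  obtain ⟨ha, ha2, -⟩ := aStar_spec hq
  have hr : 1 < r := hq.trans hqr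
  have hlt : 1 / r < 1 / q := one_div_lt_one_div_of_lt (by linarith) hqr
  have h1 : 1 / q ≤ 1 := by rw [div_le_one (by linarith)]; exact hq.le
  calc deltaStar q < deltaFun (1 / r) (aStar q) :=
        deltaFun_strictAntiOn ha ha2 ⟨by positivity, hlt.le.trans h1⟩ ⟨by positivity, h1⟩ hlt
    _ ≤ deltaStar r := deltaFun_le_deltaStar hr ha.le (by linarith)

end Delta


/-! ### Properties of `UB` and the final bounds. -/

section UpperBound

open Set Filter Topology

variable {q : ℝ}

lemma UB_one : UB 1 = 1 := by simp [UB, lambdaStar]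

lemma UB_eq (hq : 1 < q) : UB q = (1 + deltaStar q ^ (q / (q - 1))) ^ ((q - 1) / q) := by
  have : 0 < deltaStar q := one_pos.trans_le (one_le_deltaStar hq)
  rw [UB, lambdaStar, if_neg hq.ne', Real.rpow_neg (by positivity), one_div, inv_inv]

lemma one_lt_UB (hq : 1 < q) : 1 < UB q := by
  have : 0 < deltaStar q := one_pos.trans_le (one_le_deltaStar hq)
  have h1 : 0 < q - 1 := by linarith
  rw [UB_eq hq]
  exact Real.one_lt_rpow (by linarith [Real.rpow_pos_of_pos this (q / (q - 1))]) (by positivity)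

lemma one_add_rpow_antitone {p p' x : ℝ} (hx : 0 ≤ x) (hp : 0 < p) (hpp : p ≤ p') :
    (1 + x ^ p') ^ (1 / p') ≤ (1 + x ^ p) ^ (1 / p) := by
  simpa only [Real.one_rpow] using Real.rpow_add_rpow_le zero_le_one hx hp hpp

lemma UB_strictMonoOn : StrictMonoOn UB (Ici 1) := by
  intro q hq r hr hqr
  rcases (mem_Ici.1 hq).eq_or_lt with rfl | hq
  · rw [UB_one]
    exact one_lt_UB hqr
  have hr : 1 < r := hq.trans hqr
  have hδ : 0 < deltaStar q := one_pos.trans_le (one_le_deltaStar hq)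
  have hδr : 0 < deltaStar r := one_pos.trans_le (one_le_deltaStar hr)
  have hq1 : 0 < q - 1 := by linarith
  have hr1 : 0 < r - 1 := by linarith
  rw [UB_eq hq, UB_eq hr]
  calc (1 + deltaStar q ^ (q / (q - 1))) ^ ((q - 1) / q)
      < (1 + deltaStar r ^ (q / (q - 1))) ^ ((q - 1) / q) := by
        refine Real.rpow_lt_rpow (by positivity) ?_ (by positivity)
        have := Real.rpow_lt_rpow hδ.le (deltaStar_strictMono hq hqr)
          (z := q / (q - 1)) (by positivity)
        linarith
    _ ≤ (1 + deltaStar r ^ (r / (r - 1))) ^ ((r - 1) / r) := by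
        rw [← one_div_div q, ← one_div_div r]
        refine one_add_rpow_antitone hδr.le (by positivity) ?_
        rw [div_le_div_iff₀ hr1 hq1]
        nlinarith

lemma UB_le_of_near_one (hq : 1 < q) : UB q ≤ 2 ^ ((q - 1) / q) * (1 + 2 * (q - 1)) := by
  have hδ1 := one_le_deltaStar hq
  have hδ : 0 < deltaStar q := one_pos.trans_le hδ1
  have hq1 : 0 < q - 1 := by linarith
  rw [UB_eq hq]
  have h1 : 1 ≤ deltaStar q ^ (q / (q - 1)) := Real.one_le_rpow hδ1 (by positivity)
  calc (1 + deltaStar q ^ (q / (q - 1))) ^ ((q - 1) / q)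
      ≤ (2 * deltaStar q ^ (q / (q - 1))) ^ ((q - 1) / q) :=
        Real.rpow_le_rpow (by positivity) (by linarith) (by positivity)
    _ = 2 ^ ((q - 1) / q) * deltaStar q := by
        rw [Real.mul_rpow (by norm_num) (by positivity), ← Real.rpow_mul hδ.le,
          show q / (q - 1) * ((q - 1) / q) = 1 by field_simp, Real.rpow_one]
    _ ≤ _ := mul_le_mul_of_nonneg_left (deltaStar_le_of_near_one hq) (by positivity)

lemma tendsto_UB_one : Tendsto UB (𝓝[>] 1) (𝓝 1) := by
  have hup : Tendsto (fun q : ℝ => (2 : ℝ) ^ ((q - 1) / q) * (1 + 2 * (q - 1))) (𝓝[>] 1)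
      (𝓝 1) := by
    have hc : ContinuousAt (fun q : ℝ => (2 : ℝ) ^ ((q - 1) / q) * (1 + 2 * (q - 1))) 1 := by
      refine ContinuousAt.mul (ContinuousAt.rpow continuousAt_const ?_ (Or.inl (by norm_num)))
        (by fun_prop)
      exact ContinuousAt.div (by fun_prop) (by fun_prop) one_ne_zero
    have := hc.tendsto.mono_left (nhdsWithin_le_nhds (s := Ioi 1))
    simpa using this
  refine tendsto_of_tendsto_of_tendsto_of_le_of_le' tendsto_const_nhds hup ?_ ?_
  · filter_upwards [self_mem_nhdsWithin] with q hq using (one_lt_UB hq).le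
  · filter_upwards [self_mem_nhdsWithin] with q hq using UB_le_of_near_one hq

lemma tendsto_deltaStar_atTop : Tendsto deltaStar atTop (𝓝 2) := by
  have hs : Tendsto (fun q : ℝ => 1 / q) atTop (𝓝 0) := by
    simpa using tendsto_inv_atTop_zero (𝕜 := ℝ)
  -- The numerator of `deltaFun (1 / q)` at the test point `b = 1 / q`; its denominator is at most
  -- `1`.
  have hlow : Tendsto (fun q : ℝ => (q ^ (1 / q))⁻¹ + 1 - 2 * (1 / q)) atTop (𝓝 2) := by
    have := ((tendsto_rpow_div.inv₀ one_ne_zero).add_const 1).sub (hs.const_mul 2)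
    convert this using 2
    norm_num
  refine tendsto_of_tendsto_of_tendsto_of_le_of_le' hlow tendsto_const_nhds ?_ ?_
  · filter_upwards [eventually_gt_atTop 2] with q hq
    have hq0 : 0 < q := by linarith
    have hs0 : 0 < 1 / q := by positivity
    have hs1 : 1 / q < 1 / 2 := one_div_lt_one_div_of_lt (by norm_num) hq
    refine le_trans ?_ (deltaFun_le_deltaStar (by linarith) hs0.le (by linarith))
    rw [deltaFun, le_div_iff₀ (Real.rpow_pos_of_pos (by linarith) _),
      Real.div_rpow one_pos.le hq0.le, Real.one_rpow, ← one_div]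
    have h1 : (1 - 1 / q) ^ (1 / q) ≤ 1 := Real.rpow_le_one (by linarith) (by linarith) hs0.le
    have h2 : 0 < 1 / q ^ (1 / q) := by positivity
    nlinarith
  · filter_upwards [eventually_gt_atTop 1] with q hq using deltaStar_le_two hq

lemma tendsto_UB_atTop : Tendsto UB atTop (𝓝 3) := by
  have hinv : Tendsto (fun q : ℝ => (q - 1) / q) atTop (𝓝 1) := by
    have : Tendsto (fun q : ℝ => 1 - q⁻¹) atTop (𝓝 (1 - 0)) :=
      tendsto_const_nhds.sub tendsto_inv_atTop_zero
    rw [sub_zero] at this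
    refine this.congr' ?_
    filter_upwards [eventually_gt_atTop 0] with q hq
    field_simp
  have hp : Tendsto (fun q : ℝ => q / (q - 1)) atTop (𝓝 1) := by
    simpa using hinv.inv₀ one_ne_zero
  have h := ((tendsto_deltaStar_atTop.rpow hp (Or.inl two_ne_zero)).const_add 1).rpow hinv
    (Or.inl (by norm_num))
  rw [show ((1 : ℝ) + 2 ^ (1 : ℝ)) ^ (1 : ℝ) = 3 by norm_num] at h
  refine h.congr' ?_
  filter_upwards [eventually_gt_atTop 1] with q hq using (UB_eq hq).symm

lemma UB_le_three (hq : 1 ≤ q) : UB q ≤ 3 := by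
  refine ge_of_tendsto tendsto_UB_atTop ?_
  filter_upwards [eventually_ge_atTop q] with r hr
  exact UB_strictMonoOn.monotoneOn hq (hq.trans hr) hr

lemma aStar_two : aStar 2 = 1 - √3 / 2 := by
  have h3 : √3 ^ 2 = 3 := Real.sq_sqrt (by norm_num)
  have hlt : √3 < 2 := by rw [Real.sqrt_lt' (by norm_num)]; norm_num
  have hgt : 1 < √3 := by rw [Real.lt_sqrt (by norm_num)]; norm_num
  refine aStar_eq_of_root (by norm_num) (by linarith) (by linarith) ?_
  have hy : (0 : ℝ) < (√3 - 1) / 2 := by linarith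
  -- The root is a perfect square in `ℚ(√3)`, so its half-integer powers stay there.
  have ha : 1 - √3 / 2 = ((√3 - 1) / 2) ^ (2 : ℝ) := by
    rw [Real.rpow_two]
    linear_combination (-(1 / 4 : ℝ)) * h3
  unfold eqnLHS
  rw [show (1 - √3 / 2) ^ ((1 - 2 : ℝ) / 2) = ((√3 - 1) / 2)⁻¹ by
    rw [ha, ← Real.rpow_mul hy.le, show (2 : ℝ) * ((1 - 2) / 2) = -1 by norm_num,
      Real.rpow_neg_one]]
  have : √3 - 1 ≠ 0 := by linarith
  field_simp
  linear_combination (-1 : ℝ) * h3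

lemma deltaStar_two_sq : deltaStar 2 ^ 2 = 6 * √3 - 9 := by
  have h3 : √3 ^ 2 = 3 := Real.sq_sqrt (by norm_num)
  have hgt : 1 < √3 := by rw [Real.lt_sqrt (by norm_num)]; norm_num
  have hy : (0 : ℝ) ≤ (√3 - 1) / 2 := by linarith
  have ha : √(1 - √3 / 2) = (√3 - 1) / 2 := by
    rw [show 1 - √3 / 2 = ((√3 - 1) / 2) ^ 2 by linear_combination (-(1 / 4 : ℝ)) * h3]
    exact Real.sqrt_sq hy
  rw [deltaStar, aStar_two, ← Real.sqrt_eq_rpow, ← Real.sqrt_eq_rpow, ha, div_pow,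
    Real.sq_sqrt (by linarith), div_eq_iff (by linarith)]
  linear_combination (-(3 / 4 : ℝ)) * h3

lemma UB_two : UB 2 = √(6 * √3 - 8) := by
  rw [UB_eq (by norm_num), Real.sqrt_eq_rpow]
  norm_num
  rw [deltaStar_two_sq]
  ring_nf

lemma UB_two_approx : |UB 2 - 1.55| < 0.005 := by
  have h1 : 1.732 < √3 := by rw [Real.lt_sqrt (by norm_num)]; norm_num
  have h2 : √3 < 1.7321 := by rw [Real.sqrt_lt' (by norm_num)]; norm_num
  rw [UB_two, abs_lt]
  constructor
  · have : 1.545 < √(6 * √3 - 8) := by rw [Real.lt_sqrt (by norm_num)]; linarith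
    linarith
  · have : √(6 * √3 - 8) < 1.555 := by rw [Real.sqrt_lt' (by norm_num)]; linarith
    linarith

lemma scalar_bound_UB (hq : 1 < q) {v b : ℝ} (hv : 0 ≤ v) (hb : 0 ≤ b) (hb1 : b ≤ 1) :
    1 / UB q * (v + b ^ (1 / q)) + 1 / UB q * (1 - 2 * b) ≤ (v ^ q + (1 - b)) ^ (1 / q) := by
  have hδ : 0 < deltaStar q := one_pos.trans_le (one_le_deltaStar hq)
  have h1b : 0 ≤ 1 - b := by linarith
  have hU : 0 < UB q := one_pos.trans (one_lt_UB hq)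
  have hconj : q.HolderConjugate (q / (q - 1)) := Real.HolderConjugate.conjExponent hq
  -- Hölder for `(v, (1 - b) ^ (1 / q))` against `(1, δ*)`; the norm of the second vector is `UB q`.
  have h := Real.inner_le_Lp_mul_Lq_of_nonneg Finset.univ hconj
    (f := ![v, (1 - b) ^ (1 / q)]) (g := ![1, deltaStar q])
    (by intro i _; fin_cases i <;> simp <;> positivity)
    (by intro i _; fin_cases i <;> simp; positivity)
  simp only [Fin.sum_univ_two, Matrix.cons_val_zero, Matrix.cons_val_one, mul_one,
    Real.one_rpow] at h
  rw [← Real.rpow_mul h1b, one_div_mul_cancel (by linarith), Real.rpow_one, one_div_div,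
    ← UB_eq hq] at h
  have := numerator_le hq hb hb1
  rw [← mul_add, one_div_mul_eq_div, div_le_iff₀ hU]
  linarith

theorem approxRatio_le_UB (hq : 1 ≤ q) {d : ℕ} {M : Mechanism d}
    (hM : IsCoordinatewiseMedian M) :
    approxRatio (ENNReal.ofReal q) M ≤ ENNReal.ofReal (UB q) := by
  rcases hq.eq_or_lt with rfl | h
  -- At `q = 1` the scalar inequality is an identity.
  · have := approxRatio_le_of_scalar (r := 1) (c := 1) le_rfl one_pos le_rfl
      (fun v b _ _ _ => by simp only [div_one, Real.rpow_one]; linarith) hM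
    rw [div_one] at this
    rwa [UB_one]
  · have hU := one_lt_UB h
    have := approxRatio_le_of_scalar (c := 1 / UB q) hq (by positivity)
      (by rw [div_le_one (by linarith)]; exact hU.le)
      (fun v b hv hb hb1 => scalar_bound_UB h hv hb hb1) hM
    rwa [one_div_one_div] at this

theorem approxRatio_le_three {q : ℝ≥0∞} (hq : 1 ≤ q) {d : ℕ} {M : Mechanism d}
    (hM : IsCoordinatewiseMedian M) : approxRatio q M ≤ 3 := by
  induction q using ENNReal.recTopCoe with
  | top => exact approxRatio_top_le hM
  | coe r =>
    have hr : (1 : ℝ) ≤ r := by exact_mod_cast hq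
    have h := approxRatio_le_UB hr hM
    rw [ENNReal.ofReal_coe_nnreal] at h
    refine h.trans ?_
    rw [show (3 : ℝ≥0∞) = ENNReal.ofReal 3 by norm_num]
    exact ENNReal.ofReal_le_ofReal (UB_le_three hr)

end UpperBound

end CoordMedian

end

theorem theorem1 :
    -- for `q > 1`, `a*(q)` is the unique root of the equation in `(0, 1)`, and `a*(q) < 1/2`
    (∀ q : ℝ, 1 < q →
      0 < CoordMedian.aStar q ∧ CoordMedian.aStar q < 1 / 2 ∧
      CoordMedian.eqnLHS q (CoordMedian.aStar q) = 0 ∧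
      ∀ a : ℝ, 0 < a → a < 1 → CoordMedian.eqnLHS q a = 0 → a = CoordMedian.aStar q) ∧
    -- approximation guarantee in `L_q(ℝ^d)` for every real `q ≥ 1` and every `d`
    (∀ q : ℝ, 1 ≤ q → ∀ (d : ℕ) (M : CoordMedian.Mechanism d),
      CoordMedian.IsCoordinatewiseMedian M →
      CoordMedian.approxRatio (ENNReal.ofReal q) M ≤ ENNReal.ofReal (CoordMedian.UB q)) ∧
    -- `UB` is increasing on `[1, ∞)`
    StrictMonoOn CoordMedian.UB (Set.Ici 1) ∧
    -- `UB(1) = 1`, which is also the limit of `UB(q)` as `q` decreases to `1`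
    CoordMedian.UB 1 = 1 ∧
    Filter.Tendsto CoordMedian.UB (nhdsWithin 1 (Set.Ioi 1)) (nhds 1) ∧
    -- `UB(2) = √(6√3 - 8) ≈ 1.55`
    CoordMedian.UB 2 = Real.sqrt (6 * Real.sqrt 3 - 8) ∧
    |CoordMedian.UB 2 - 1.55| < 0.005 ∧
    -- `UB(q) → 3` as `q → ∞`
    Filter.Tendsto CoordMedian.UB Filter.atTop (nhds 3) ∧
    -- the ratio is at most `3` for every `q ∈ [1, ∞]`, including `q = ∞`
    (∀ q : ENNReal, 1 ≤ q → ∀ (d : ℕ) (M : CoordMedian.Mechanism d),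
      CoordMedian.IsCoordinatewiseMedian M → CoordMedian.approxRatio q M ≤ 3) := by
  open CoordMedian in
  exact ⟨fun q hq =>
      ⟨(aStar_spec hq).1, (aStar_spec hq).2.1, (aStar_spec hq).2.2, fun a ha ha1 h0 =>
        (aStar_eq_of_root hq ha ha1 h0).symm⟩,
    fun _ hq _ _ hM => approxRatio_le_UB hq hM, UB_strictMonoOn, UB_one, tendsto_UB_one, UB_two,
    UB_two_approx, tendsto_UB_atTop, fun _ hq _ _ hM => approxRatio_le_three hq hM⟩
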